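/- A finite dimensional reproducing kernel Hilbert space (RKHS) $H$ is a finite dimensional complex inner product space together with a distinguished basis $\{k_x\}_{x\in X}$ of kernel functions indexed by a finite set $X=X(H)$, such that $k_{xy}:=\langle k_x,k_y\rangle\neq 0$ for all $x\neq y$ in $X$. Vectors $h\in H$ are regarded as functions on $X$ by $h(x)=\langle h,k_x\rangle$ (inner products are linear in the first variable). For $Y\subseteq X$ let $H_Y$ be the span of $\{k_y\}_{y\in Y}$, with these kernel functions. A function $m:X\to\mathbb{C}^{s\times t}$ is the symbol of the matrix-valued multiplier $M_m:H\otimes\mathbb{C}^t\to H\otimes\mathbb{C}^s$, $(M_mh)(x)=m(x)h(x)$. The space $H$ has the complete Pick property (CPP) if for all $s,t$, all $Y\subseteq X$ and every $w:Y\to\mathbb{C}^{s\times t}$ whose multiplier on $H_Y$ has operator norm $1$, there is $m:X\to\mathbb{C}^{s\times t}$ with $m|_Y=w$ whose multiplier on $H$ has operator norm $1$. An RKHS $\widetilde H$ is a rescaling of $H$, written $H\sim\widetilde H$, if there are a bijection $\Xi:X(H)\to X(\widetilde H)$ and a nonvanishing $\gamma:X(H)\to\mathbb{C}$ with $\tilde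 k_{\Xi(x)\Xi(y)}=\gamma(x)\overline{\gamma(y)}\,k_{xy}$ for all $x,y\in X(H)$. Let $\mathbb{CH}^n$ be complex hyperbolic space in its ball model, i.e. the open unit ball of $\mathbb{C}^n$; let $DA_n$ be the Drury–Arveson space, the Hilbert space of functions on this ball with reproducing kernel $k_z(w)=(1-\langle w,z\rangle)^{-1}$; and for finite $Y\subset\mathbb{CH}^n$ let $DA_n(Y)$ be the subspace of $DA_n$ spanned by $\{k_y\}_{y\in Y}$, with these kernel functions. **Theorem 5.9.** If $H^+$ is a finite dimensional RKHS with the CPP, then there are an integer $n\ge 1$ and a finite set $X^+\subset\mathbb{CH}^n$ such that $H^+\sim DA_n(X^+)$. -/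

import Mathlib

open scoped ComplexConjugate

noncomputable section

/-- An RKHS with kernel functions indexed by `X`: a complex inner product space `H` together with
a distinguished basis `(k_x)_{x ∈ X}` of reproducing kernels, which is irreducible: the inner
products `⟨k_x, k_y⟩` do not vanish (linear independence of `k_x`, `k_y` for `x ≠ y` is part of
being a basis). It is finite dimensional exactly when `X` is finite. -/
structure KernelSpace (X H : Type*) [NormedAddCommGroup H] [InnerProductSpace ℂ H] where
  ker : Module.Basis X ℂ H
  irreducible : ∀ x y, x ≠ y → inner ℂ (ker x) (ker y) ≠ 0

namespace KernelSpace

section Basic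

variable {X H : Type*} [NormedAddCommGroup H] [InnerProductSpace ℂ H]

/-- The value `h(x) = ⟨h, k_x⟩` of `h ∈ H` at `x ∈ X`. (Mathlib's inner product is linear in the
second variable, the usual one here is linear in the first, whence the order.) -/
def value (K : KernelSpace X H) (h : H) (x : X) : ℂ := inner ℂ (K.ker x) h

/-- The Gram matrix entry `k_{xy} = ⟨k_x, k_y⟩ = k_x(y)`. -/
def gram (K : KernelSpace X H) (x y : X) : ℂ := K.value (K.ker x) y

/-- The vectors of `H` regarded as functions on the finite set `X`; every function on `X` arises
from exactly one vector. -/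
def funEquiv [Finite X] (K : KernelSpace X H) : H ≃ₗ[ℂ] (X → ℂ) :=
  haveI : FiniteDimensional ℂ H := Module.Basis.finiteDimensional_of_finite K.ker
  LinearMap.linearEquivOfInjective
    { toFun := fun h x => K.value h x
      map_add' := fun _ _ => funext fun _ => inner_add_right _ _ _
      map_smul' := fun _ _ => funext fun _ => inner_smul_right _ _ _ }
    (by
      intro f g h
      exact InnerProductSpace.ext_inner_left_basis K.ker fun x => congrFun h x)
    (by
      have := Fintype.ofFinite X
      rw [Module.finrank_eq_card_basis K.ker, Module.finrank_fintype_fun_eq_card])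

@[simp]
theorem funEquiv_apply [Finite X] (K : KernelSpace X H) (h : H) (x : X) :
    K.funEquiv h x = K.value h x := rfl

/-- For `Y ⊆ X`, the space `H_Y`: the span of `{k_y : y ∈ Y}` with these kernel functions. -/
def restrict (K : KernelSpace X H) (Y : Set X) :
    KernelSpace Y (Submodule.span ℂ (Set.range fun y : Y => K.ker y)) where
  ker := Module.Basis.span (K.ker.linearIndependent.comp _ Subtype.val_injective)
  irreducible := by
    intro x y hxy
    rw [Submodule.coe_inner, Module.Basis.span_apply, Module.Basis.span_apply]
    exact K.irreducible x y fun h => hxy (Subtype.ext h)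

/-- The matrix-valued multiplier operator `M_m : H ⊗ ℂᵗ → H ⊗ ℂˢ` with symbol
`m : X → ℂ^{s × t}`, that is `(M_m h)(x) = m(x) h(x)`. Here `H ⊗ ℂᵗ` is the Hilbert space
of `t`-tuples of vectors of `H`. The scalar multipliers are those with `s = t = 1`. -/
def multiplier [Finite X] (K : KernelSpace X H) {s t : ℕ} (m : X → Matrix (Fin s) (Fin t) ℂ) :
    PiLp 2 (fun _ : Fin t => H) →L[ℂ] PiLp 2 (fun _ : Fin s => H) :=
  haveI : FiniteDimensional ℂ H := Module.Basis.finiteDimensional_of_finite K.ker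
  LinearMap.toContinuousLinearMap
    { toFun := fun h => WithLp.toLp 2 fun i =>
        K.funEquiv.symm fun x => (m x).mulVec (fun j => K.value (h j) x) i
      map_add' := fun f g => by
        ext i
        simp only [PiLp.add_apply]
        rw [← map_add]
        congr 1
        funext x
        simp [value, Matrix.mulVec, dotProduct, mul_add, Finset.sum_add_distrib]
      map_smul' := fun c f => by
        ext i
        simp only [PiLp.smul_apply, RingHom.id_apply]
        rw [← map_smul]
        congr 1
        funext x
        simp [value, Matrix.mulVec, dotProduct, Finset.mul_sum, mul_left_comm] }

/-- `(M_m h)(x) = m(x) h(x)`. -/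
theorem value_multiplier [Finite X] (K : KernelSpace X H) {s t : ℕ}
    (m : X → Matrix (Fin s) (Fin t) ℂ) (h : PiLp 2 (fun _ : Fin t => H)) (i : Fin s) (x : X) :
    K.value (K.multiplier m h i) x = (m x).mulVec (fun j => K.value (h j) x) i :=
  congrFun (K.funEquiv.apply_symm_apply fun x => (m x).mulVec (fun j => K.value (h j) x) i) x

/-- The complete Pick property: for all matrix sizes `s × t` and all `Y ⊆ X`, every matrix-valued
multiplier of `H_Y` of operator norm one is the restriction of a matrix-valued multiplier of `H`
of operator norm one. -/
def CompletePick [Finite X] (K : KernelSpace X H) : Prop :=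
  ∀ (s t : ℕ) (Y : Set X) (w : Y → Matrix (Fin s) (Fin t) ℂ),
    ‖(K.restrict Y).multiplier w‖ = 1 →
      ∃ m : X → Matrix (Fin s) (Fin t) ℂ, ‖K.multiplier m‖ = 1 ∧ ∀ y : Y, m y = w y

/-- `K ∼ K'`: `K'` is a rescaling of `K`. -/
def Rescales {X' H' : Type*} [NormedAddCommGroup H'] [InnerProductSpace ℂ H']
    (K : KernelSpace X H) (K' : KernelSpace X' H') : Prop :=
  ∃ (Ξ : X ≃ X') (γ : X → ℂ), (∀ x, γ x ≠ 0) ∧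
    ∀ x y, K'.gram (Ξ x) (Ξ y) = γ x * conj (γ y) * K.gram x y

end Basic

end KernelSpace

/-- The points of complex hyperbolic space `ℂℍⁿ` in its ball model: the open unit ball of `ℂⁿ`.
Only the underlying set matters here, not the hyperbolic metric. -/
abbrev CHyp (n : ℕ) : Type := Metric.ball (0 : EuclideanSpace ℂ (Fin n)) 1

namespace CHyp

theorem norm_inner_lt_one {n : ℕ} (z w : CHyp n) :
    ‖inner ℂ (z : EuclideanSpace ℂ (Fin n)) (w : EuclideanSpace ℂ (Fin n))‖ < 1 := by
  have hz : ‖(z : EuclideanSpace ℂ (Fin n))‖ < 1 := mem_ball_zero_iff.1 z.2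
  have hw : ‖(w : EuclideanSpace ℂ (Fin n))‖ < 1 := mem_ball_zero_iff.1 w.2
  refine (norm_inner_le_norm _ _).trans_lt ?_
  nlinarith [norm_nonneg (z : EuclideanSpace ℂ (Fin n)),
    norm_nonneg (w : EuclideanSpace ℂ (Fin n))]

theorem one_sub_inner_ne_zero {n : ℕ} (z w : CHyp n) :
    1 - inner ℂ (z : EuclideanSpace ℂ (Fin n)) (w : EuclideanSpace ℂ (Fin n)) ≠ 0 := by
  intro h
  have := norm_inner_lt_one z w
  rw [← sub_eq_zero.1 h] at this
  simp at this

end CHyp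

/-- The Drury-Arveson kernel `k_z(w) = 1 / (1 - ⟨w, z⟩)` on the ball, entry `(w, z)`, as an
operator-valued kernel on the one dimensional space `ℂ`. -/
def daKernel (n : ℕ) : Matrix (CHyp n) (CHyp n) (ℂ →L[ℂ] ℂ) :=
  .of fun w z => (1 - inner ℂ (z : EuclideanSpace ℂ (Fin n)) (w : EuclideanSpace ℂ (Fin n)))⁻¹ •
    ContinuousLinearMap.id ℂ ℂ

theorem daKernel_pow_nonneg {n : ℕ} (s : Finset (CHyp n)) (c : CHyp n → ℂ) (m : ℕ) :
    0 ≤ (∑ z ∈ s, ∑ w ∈ s, conj (c z) * c w *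
      (inner ℂ (z : EuclideanSpace ℂ (Fin n)) (w : EuclideanSpace ℂ (Fin n))) ^ m).re := by
  classical
  induction m generalizing c with
  | zero =>
    have : (∑ z ∈ s, ∑ w ∈ s, conj (c z) * c w *
        (inner ℂ (z : EuclideanSpace ℂ (Fin n)) (w : EuclideanSpace ℂ (Fin n))) ^ 0)
        = ((Complex.normSq (∑ z ∈ s, c z) : ℝ) : ℂ) := by
      rw [Complex.normSq_eq_conj_mul_self, map_sum, Finset.sum_mul_sum]
      simp
    rw [this, Complex.ofReal_re]
    exact Complex.normSq_nonneg _
  | succ m ih =>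
    have : (∑ z ∈ s, ∑ w ∈ s, conj (c z) * c w *
        (inner ℂ (z : EuclideanSpace ℂ (Fin n)) (w : EuclideanSpace ℂ (Fin n))) ^ (m + 1))
        = ∑ i, ∑ z ∈ s, ∑ w ∈ s, conj (c z * z.1 i) * (c w * w.1 i) *
        (inner ℂ (z : EuclideanSpace ℂ (Fin n)) (w : EuclideanSpace ℂ (Fin n))) ^ m := by
      rw [Finset.sum_comm (s := Finset.univ)]
      refine Finset.sum_congr rfl fun z _ => ?_
      rw [Finset.sum_comm (s := Finset.univ)]
      refine Finset.sum_congr rfl fun w _ => ?_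
      rw [← Finset.sum_mul, pow_succ, mul_comm (_ ^ m), ← mul_assoc]
      congr 1
      rw [PiLp.inner_apply, Finset.mul_sum]
      refine Finset.sum_congr rfl fun i _ => ?_
      simp [RCLike.inner_apply]
      ring
    rw [this, Complex.re_sum]
    exact Finset.sum_nonneg fun i _ => ih _

open scoped ComplexOrder in
theorem daKernel_posSemidef (n : ℕ) : (daKernel n).PosSemidef := by
  have tfae := RKHS.posSemidef_tfae (K := daKernel n)
  refine (tfae.out 0 2 rfl rfl).2 ⟨?_, fun c => ?_⟩
  · ext z w
    simp [daKernel, ContinuousLinearMap.star_eq_adjoint, ContinuousLinearMap.adjoint_id]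
  · simp only [Finsupp.sum]
    have key : HasSum (fun m : ℕ => ∑ z ∈ c.support, ∑ w ∈ c.support,
        conj (conj (c z)) * conj (c w) *
        (inner ℂ (z : EuclideanSpace ℂ (Fin n)) (w : EuclideanSpace ℂ (Fin n))) ^ m)
        (∑ z ∈ c.support, ∑ w ∈ c.support, inner ℂ (daKernel n z w (c w)) (c z)) := by
      refine hasSum_sum fun z _ => hasSum_sum fun w _ => ?_
      have := (hasSum_geometric_of_norm_lt_one (CHyp.norm_inner_lt_one z w)).mul_left
        (conj (conj (c z)) * conj (c w))
      have h : inner ℂ (daKernel n z w (c w)) (c z) = conj (conj (c z)) * conj (c w) *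
          (1 - inner ℂ (z : EuclideanSpace ℂ (Fin n)) (w : EuclideanSpace ℂ (Fin n)))⁻¹ := by
        simp [daKernel]
        ring
      rwa [h]
    rw [Finset.sum_comm]
    exact (Complex.hasSum_re key).nonneg fun m =>
      daKernel_pow_nonneg c.support (fun z => conj (c z)) m

instance fact_daKernel_posSemidef (n : ℕ) : Fact (daKernel n).PosSemidef := ⟨daKernel_posSemidef n⟩

/-- The Drury-Arveson space `DA_n`: the reproducing kernel Hilbert space of functions on the ball
with the Drury-Arveson kernel. -/
abbrev DruryArveson (n : ℕ) : Type := RKHS.OfKernel (daKernel n)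

/-- The reproducing kernel `k_z ∈ DA_n`. -/
def daKer {n : ℕ} (z : CHyp n) : DruryArveson n := RKHS.kerFun (DruryArveson n) z 1

theorem daKer_apply {n : ℕ} (z w : CHyp n) :
    daKer z w = (1 - inner ℂ (z : EuclideanSpace ℂ (Fin n))
      (w : EuclideanSpace ℂ (Fin n)))⁻¹ := by
  rw [daKer, RKHS.kerFun_apply, RKHS.OfKernel.kernel_ofKernel]
  simp [daKernel]

theorem inner_daKer {n : ℕ} (z : CHyp n) (f : DruryArveson n) : inner ℂ (daKer z) f = f z := by
  rw [daKer, RKHS.kerFun_inner]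
  simp

theorem linearIndependent_daKer (n : ℕ) : LinearIndependent ℂ (daKer (n := n)) := by
  classical
  rw [linearIndependent_iff']
  intro S g hg
  -- a direction `v` on which the points of `S` have distinct projections
  obtain ⟨v, hv⟩ := Module.Dual.exists_forall_ne_zero_of_forall_exists (K := ℂ)
    (M := EuclideanSpace ℂ (Fin n))
    (fun p : {p : S × S // p.1 ≠ p.2} =>
      (innerSL ℂ ((p.1.1.1.1 : EuclideanSpace ℂ (Fin n)) - p.1.2.1.1)).toLinearMap)
    (fun p => ⟨(p.1.1.1.1 : EuclideanSpace ℂ (Fin n)) - p.1.2.1.1, by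
      have hp : (p.1.1.1.1 : EuclideanSpace ℂ (Fin n)) - p.1.2.1.1 ≠ 0 := fun h =>
        p.2 (Subtype.ext (Subtype.ext (sub_eq_zero.1 h)))
      exact fun h => hp (inner_self_eq_zero.1 h)⟩)
  set a : CHyp n → ℂ := fun z => inner ℂ (z : EuclideanSpace ℂ (Fin n)) v with ha
  have hinj : ∀ z ∈ S, ∀ w ∈ S, z ≠ w → a z ≠ a w := by
    intro z hz w hw hzw h
    refine hv ⟨(⟨z, hz⟩, ⟨w, hw⟩), fun h => hzw (congrArg Subtype.val h)⟩ ?_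
    simpa [inner_sub_left, sub_eq_zero] using h
  let P : Polynomial ℂ := ∑ z ∈ S, Polynomial.C (g z) *
    ∏ w ∈ S.erase z, (Polynomial.X - Polynomial.C (a w))
  have hP : P = 0 := by
    refine Polynomial.eq_zero_of_infinite_isRoot P ?_
    refine Set.Infinite.mono (s := (fun r : ℝ => (r : ℂ)) '' Set.Ioi (‖v‖ + 1)) ?_
      ((Set.Ioi_infinite _).image Complex.ofReal_injective.injOn)
    rintro _ ⟨r, hr, rfl⟩
    have hr : ‖v‖ + 1 < r := hr
    have hr0 : 0 < r := by linarith [norm_nonneg v]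
    have hrC : (r : ℂ) ≠ 0 := by exact_mod_cast hr0.ne'
    have hball : ((r : ℂ)⁻¹ • v) ∈ Metric.ball (0 : EuclideanSpace ℂ (Fin n)) 1 := by
      rw [mem_ball_zero_iff, norm_smul, norm_inv, Complex.norm_real, Real.norm_of_nonneg hr0.le,
        inv_mul_lt_iff₀ hr0]
      linarith
    have hne : ∀ z : CHyp n, (r : ℂ) - a z ≠ 0 := by
      intro z h
      have := CHyp.one_sub_inner_ne_zero z ⟨_, hball⟩
      apply this
      rw [inner_smul_right]
      change 1 - (r : ℂ)⁻¹ * a z = 0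
      rw [← sub_eq_zero.1 h, inv_mul_cancel₀ hrC, sub_self]
    have h0 : ∑ z ∈ S, g z * (r / (r - a z)) = 0 := by
      have h1 : inner ℂ (daKer (⟨_, hball⟩ : CHyp n)) (∑ z ∈ S, g z • daKer z) = 0 := by
        rw [hg, inner_zero_right]
      rw [inner_sum] at h1
      rw [← h1]
      refine Finset.sum_congr rfl fun z _ => ?_
      rw [inner_smul_right, inner_daKer, daKer_apply, inner_smul_right]
      change _ = g z * (1 - (r : ℂ)⁻¹ * a z)⁻¹
      congr 1
      rw [← div_eq_inv_mul, one_sub_div hrC, inv_div]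
    have h2 : (r : ℂ) * P.eval (r : ℂ) = (∏ w ∈ S, ((r : ℂ) - a w)) *
        ∑ z ∈ S, g z * (r / (r - a z)) := by
      simp only [P, Polynomial.eval_finsetSum, Polynomial.eval_mul, Polynomial.eval_C,
        Polynomial.eval_prod, Polynomial.eval_sub, Polynomial.eval_X, Finset.mul_sum]
      refine Finset.sum_congr rfl fun z hz => ?_
      rw [← Finset.mul_prod_erase S _ hz]
      have := hne z
      field_simp
    rw [h0, mul_zero] at h2
    exact (mul_eq_zero.1 h2).resolve_left hrC
  intro z hz
  have h := congrArg (Polynomial.eval (a z)) hP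
  simp only [P, Polynomial.eval_finsetSum, Polynomial.eval_mul, Polynomial.eval_C,
    Polynomial.eval_prod, Polynomial.eval_sub, Polynomial.eval_X, Polynomial.eval_zero] at h
  rw [Finset.sum_eq_single_of_mem z hz] at h
  · refine (mul_eq_zero.1 h).resolve_right (Finset.prod_ne_zero_iff.2 fun w hw => ?_)
    exact sub_ne_zero.2 (hinj z hz w (Finset.mem_of_mem_erase hw) (Finset.ne_of_mem_erase hw).symm)
  · intro w _ hwz
    rw [Finset.prod_eq_zero (Finset.mem_erase.2 ⟨hwz.symm, hz⟩) (sub_self _), mul_zero]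

/-- `DA_n(Y)`: the subspace of `DA_n` spanned by the kernel functions `k_y`, `y ∈ Y`. -/
def DA (n : ℕ) (Y : Set (CHyp n)) :
    KernelSpace Y (Submodule.span ℂ (Set.range fun y : Y => daKer (y : CHyp n))) where
  ker := Module.Basis.span ((linearIndependent_daKer n).comp _ Subtype.val_injective)
  irreducible := by
    intro x y _
    rw [Submodule.coe_inner, Module.Basis.span_apply, Module.Basis.span_apply]
    change inner ℂ (daKer (x : CHyp n)) (daKer (y : CHyp n)) ≠ 0
    rw [inner_daKer, daKer_apply]
    exact inv_ne_zero (CHyp.one_sub_inner_ne_zero _ _)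

end

/-! Fix a base point `x₀`. Dividing the kernel by its `x₀` row and column turns it into `1 / (1 -
F)` up to rescaling, with `F` essentially `pickMatrix x₀`. If `F` is positive semidefinite, it is
the Gram matrix of vectors `b x`, and these are the required points of the ball, with `x₀` sent to
the origin.

Positivity is proved on subsets `S` by induction, for all base points at once. The row and column of
`pickMatrix x₁` at `x₁` vanish, so positivity on `S` with base `x₁` gives it on `insert x₁ S` with
the same base. The Pick property then moves the base to any `x₀` (`posSemidef_maskMatrix_of_mem`): a
factorisation of `pickMatrix x₁` on `S` is a contractive row multiplier, and compressing its
contractive extension to the functions vanishing at `x₀` gives positivity of `pickMatrix x₀` on `S`.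
-/

namespace KernelSpace

variable {X H : Type*} [NormedAddCommGroup H] [InnerProductSpace ℂ H]

/-! ### Contractive row multipliers and their extension -/

theorem norm_sq_sum_smul [Fintype X] (v : X → H) (c : X → ℂ) :
    ((‖∑ x, c x • v x‖ ^ 2 : ℝ) : ℂ) = ∑ x, ∑ y, conj (c x) * c y * inner ℂ (v x) (v y) := by
  have h := inner_self_eq_norm_sq_to_K (𝕜 := ℂ) (∑ x, c x • v x)
  push_cast
  refine h.symm.trans ?_
  rw [sum_inner]
  refine Finset.sum_congr rfl fun x _ => ?_
  rw [inner_sum]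
  refine Finset.sum_congr rfl fun y _ => ?_
  rw [inner_smul_left, inner_smul_right]
  ring

/-- Together with `norm_sq_sum_smul`, this turns contractivity into positivity of the entrywise
product of the Gram matrix with `1 - m(x) m(y)^*`. -/
theorem sum_norm_sq_sum_smul [Fintype X] {ι : Type*} [Fintype ι] (v : X → H) (w : ι → X → ℂ)
    (c : X → ℂ) :
    ((∑ j, ‖∑ x, (c x * w j x) • v x‖ ^ 2 : ℝ) : ℂ) =
      ∑ x, ∑ y, conj (c x) * c y * (∑ j, conj (w j x) * w j y) * inner ℂ (v x) (v y) := by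
  rw [Complex.ofReal_sum]
  simp only [norm_sq_sum_smul]
  rw [Finset.sum_comm]
  refine Finset.sum_congr rfl fun x _ => ?_
  rw [Finset.sum_comm]
  refine Finset.sum_congr rfl fun y _ => ?_
  rw [Finset.mul_sum, Finset.sum_mul]
  refine Finset.sum_congr rfl fun j _ => ?_
  rw [map_mul]
  ring

/-- The adjoint of a row multiplier maps `k_x` to `m(x)^* k_x`; hence a row multiplier is
contractive if and only if the operator `∑ c_x k_x ↦ ∑ c_x m(x)^* k_x` is. -/
theorem norm_multiplier_le_one_iff [Fintype X] (K : KernelSpace X H) {t : ℕ}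
    (m : X → Matrix (Fin 1) (Fin t) ℂ) :
    ‖K.multiplier m‖ ≤ 1 ↔ ∀ c : X → ℂ,
      ∑ j, ‖∑ x, (c x * conj (m x 0 j)) • K.ker x‖ ^ 2 ≤ ‖∑ x, c x • K.ker x‖ ^ 2 := by
  have : FiniteDimensional ℂ H := Module.Basis.finiteDimensional_of_finite K.ker
  have : CompleteSpace H := FiniteDimensional.complete ℂ H
  have adj_ker : ∀ x, (K.multiplier m).adjoint (WithLp.toLp 2 fun _ => K.ker x) =
      WithLp.toLp 2 fun j => conj (m x 0 j) • K.ker x := by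
    intro x
    refine ext_inner_right ℂ fun h => ?_
    rw [ContinuousLinearMap.adjoint_inner_left, PiLp.inner_apply, PiLp.inner_apply]
    have := K.value_multiplier m h 0 x
    rw [value] at this
    simp only [Fin.sum_univ_one, Fin.isValue]
    rw [this]
    simp [Matrix.mulVec, dotProduct, inner_smul_left, value]
  have adj : ∀ c : X → ℂ, (K.multiplier m).adjoint (WithLp.toLp 2 fun _ => ∑ x, c x • K.ker x) =
      WithLp.toLp 2 fun j => ∑ x, (c x * conj (m x 0 j)) • K.ker x := by
    intro c
    have h1 : (WithLp.toLp 2 fun _ => ∑ x, c x • K.ker x : PiLp 2 (fun _ : Fin 1 => H)) =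
        ∑ x, c x • WithLp.toLp 2 fun _ => K.ker x := by
      ext i
      simp
    rw [h1, map_sum]
    simp only [map_smul, adj_ker]
    ext j
    simp [mul_smul]
  have norm_adj : ‖K.multiplier m‖ = ‖(K.multiplier m).adjoint‖ :=
    (LinearIsometryEquiv.norm_map ContinuousLinearMap.adjoint _).symm
  rw [norm_adj]
  constructor
  · intro h c
    have h2 := (K.multiplier m).adjoint.le_of_opNorm_le h
      (WithLp.toLp 2 fun _ => ∑ x, c x • K.ker x)
    rw [adj, one_mul, ← sq_le_sq₀ (norm_nonneg _) (norm_nonneg _), PiLp.norm_sq_eq_of_L2,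
      PiLp.norm_sq_eq_of_L2] at h2
    simpa using h2
  · intro h
    refine ContinuousLinearMap.opNorm_le_bound _ zero_le_one fun f => ?_
    have hf : f = WithLp.toLp 2 fun _ => ∑ x, K.ker.repr (f 0) x • K.ker x := by
      ext i
      rw [Subsingleton.elim i 0]
      exact (K.ker.sum_repr (f 0)).symm
    rw [hf, adj, one_mul, ← sq_le_sq₀ (norm_nonneg _) (norm_nonneg _), PiLp.norm_sq_eq_of_L2,
      PiLp.norm_sq_eq_of_L2]
    simpa only [Finset.sum_const, Finset.card_univ, Fintype.card_fin, one_smul] using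
      h fun x => K.ker.repr (f 0) x

theorem multiplier_smul [Finite X] (K : KernelSpace X H) {s t : ℕ} (a : ℂ)
    (m : X → Matrix (Fin s) (Fin t) ℂ) : K.multiplier (a • m) = a • K.multiplier m := by
  ext h i
  refine K.funEquiv.injective (funext fun x => ?_)
  have h1 := K.value_multiplier (a • m) h i x
  have h2 := K.value_multiplier m h i x
  rw [funEquiv_apply, funEquiv_apply, h1, _root_.smul_apply, PiLp.smul_apply, value,
    inner_smul_right, ← value, h2]
  simp [Matrix.smul_mulVec]

theorem norm_smul_continuousLinearMap {E F : Type*} [NormedAddCommGroup E] [NormedSpace ℂ E]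
    [NormedAddCommGroup F] [NormedSpace ℂ F] (a : ℂ) (T : E →L[ℂ] F) : ‖a • T‖ = ‖a‖ * ‖T‖ :=
  norm_smul a T

theorem continuousLinearMap_eq_zero_of_norm_eq_zero {E F : Type*} [NormedAddCommGroup E]
    [NormedSpace ℂ E] [NormedAddCommGroup F] [NormedSpace ℂ F] {T : E →L[ℂ] F} (h : ‖T‖ = 0) :
    T = 0 :=
  norm_eq_zero.1 h

theorem norm_multiplier_smul [Finite X] (K : KernelSpace X H) {s t : ℕ} (a : ℂ)
    (m : X → Matrix (Fin s) (Fin t) ℂ) : ‖K.multiplier (a • m)‖ = ‖a‖ * ‖K.multiplier m‖ := by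
  rw [multiplier_smul]
  exact norm_smul_continuousLinearMap a _

/-- Contractive multipliers extend to contractive multipliers. -/
theorem CompletePick.exists_norm_le_one [Finite X] {K : KernelSpace X H} (hK : K.CompletePick)
    {s t : ℕ} (Y : Set X) (w : Y → Matrix (Fin s) (Fin t) ℂ)
    (hw : ‖(K.restrict Y).multiplier w‖ ≤ 1) :
    ∃ m : X → Matrix (Fin s) (Fin t) ℂ, ‖K.multiplier m‖ ≤ 1 ∧ ∀ y : Y, m y = w y := by
  set r := ‖(K.restrict Y).multiplier w‖ with hr
  have hr0 : 0 ≤ r := ContinuousLinearMap.opNorm_nonneg _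
  rcases eq_or_ne r 0 with h0 | h0
  -- A zero multiplier cannot be normalised, but its symbol is zero: test it on the vector whose
  -- values are all `1`.
  · refine ⟨0, ?_, fun y => ?_⟩
    · have := K.norm_multiplier_smul 0 (0 : X → Matrix (Fin s) (Fin t) ℂ)
      rw [smul_zero, norm_zero, zero_mul] at this
      exact this.trans_le zero_le_one
    · have hz : (K.restrict Y).multiplier w = 0 := 
        continuousLinearMap_eq_zero_of_norm_eq_zero (hr.symm.trans h0)
      ext i j
      let K' := K.restrict Y
      obtain ⟨f, hf⟩ := K'.funEquiv.surjective (fun _ => 1)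
      have h1 := K'.value_multiplier w
        (WithLp.toLp 2 fun l => if l = j then f else 0) i y
      have hf' : K'.value f y = 1 := by rw [← funEquiv_apply, hf]
      rw [hz] at h1
      have h2 : ∀ l, K'.value (if l = j then f else 0) y = if l = j then 1 else 0 := by
        intro l
        split_ifs
        · exact hf'
        · simp [value]
      simp only [h2] at h1
      simpa [value, Matrix.mulVec, dotProduct] using h1
  · obtain ⟨m, hm, hmw⟩ := hK s t Y ((r : ℂ)⁻¹ • w) (by
      rw [norm_multiplier_smul, norm_inv, Complex.norm_real, Real.norm_of_nonneg
        hr0, ← hr, inv_mul_cancel₀ h0])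
    refine ⟨(r : ℂ) • m, ?_, fun y => ?_⟩
    · rw [norm_multiplier_smul, hm, mul_one, Complex.norm_real, Real.norm_of_nonneg
        hr0]
      exact hw
    · rw [Pi.smul_apply, hmw, Pi.smul_apply, smul_smul, mul_inv_cancel₀
        (Complex.ofReal_ne_zero.2 h0), one_smul]

/-! ### Compression to the functions vanishing at a point -/

theorem inner_ker_ne_zero (K : KernelSpace X H) (x y : X) :
    inner ℂ (K.ker x) (K.ker y) ≠ 0 := by
  rcases eq_or_ne x y with rfl | h
  · exact inner_self_ne_zero.2 (K.ker.ne_zero x)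
  · exact K.irreducible x y h

/-- The component of a vector orthogonal to `u`. -/
noncomputable def orthComponent (u : H) : H →ₗ[ℂ] H where
  toFun v := v - (inner ℂ u v / inner ℂ u u) • u
  map_add' v w := by
    rw [inner_add_right, add_div, add_smul]
    abel
  map_smul' a v := by
    rw [inner_smul_right, mul_div_assoc, mul_smul, smul_sub, RingHom.id_apply]

theorem orthComponent_apply (u v : H) :
    orthComponent u v = v - (inner ℂ u v / inner ℂ u u) • u := rfl

theorem orthComponent_self {u : H} (hu : u ≠ 0) : orthComponent u u = 0 := by
  rw [orthComponent_apply, div_self (inner_self_ne_zero.2 hu), one_smul, sub_self]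

theorem inner_orthComponent {u : H} (hu : u ≠ 0) (v w : H) :
    inner ℂ (orthComponent u v) (orthComponent u w) =
      inner ℂ v w - inner ℂ v u * inner ℂ u w / inner ℂ u u := by
  have hu' : inner ℂ u u ≠ 0 := inner_self_ne_zero (𝕜 := ℂ).2 hu
  simp only [orthComponent_apply, inner_sub_left, inner_sub_right, inner_smul_left,
    inner_smul_right, map_div₀, inner_conj_symm]
  field_simp
  ring

theorem norm_orthComponent_le {u : H} (hu : u ≠ 0) (v : H) : ‖orthComponent u v‖ ≤ ‖v‖ := by
  have hu' : inner ℂ u u ≠ 0 := inner_self_ne_zero (𝕜 := ℂ).2 hu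
  have h : inner ℂ (orthComponent u v) ((inner ℂ u v / inner ℂ u u) • u) = 0 := by
    rw [inner_smul_right, orthComponent_apply, inner_sub_left, inner_smul_left, map_div₀,
      inner_conj_symm, inner_conj_symm, div_mul_cancel₀ _ hu', sub_self, mul_zero]
  have h2 := norm_add_sq_eq_norm_sq_add_norm_sq_of_inner_eq_zero _ _ h
  rw [orthComponent_apply, sub_add_cancel, ← orthComponent_apply] at h2
  refine le_of_sq_le_sq ?_ (norm_nonneg v)
  nlinarith [mul_self_nonneg ‖(inner ℂ u v / inner ℂ u u) • u‖]

open scoped ComplexOrder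

/-- A contractive row multiplier restricts to a contraction of the space of functions
vanishing at `x₀`. -/
theorem nonneg_of_norm_multiplier_le_one [Fintype X] (K : KernelSpace X H) {t : ℕ}
    {m : X → Matrix (Fin 1) (Fin t) ℂ} (hm : ‖K.multiplier m‖ ≤ 1) (x₀ : X) (a : X → ℂ) :
    0 ≤ ∑ x, ∑ y, conj (a x) * a y * (1 - ∑ j, m x 0 j * conj (m y 0 j)) *
      (inner ℂ (K.ker x) (K.ker y) - inner ℂ (K.ker x) (K.ker x₀) *
        inner ℂ (K.ker x₀) (K.ker y) / inner ℂ (K.ker x₀) (K.ker x₀)) := by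
  classical
  set P := orthComponent (K.ker x₀) with hP
  have hx₀ : K.ker x₀ ≠ 0 := K.ker.ne_zero x₀
  set v := ∑ x, a x • K.ker x with hv
  -- Coefficients of `P v`. They differ from `a` only at `x₀`, where `P` kills the kernel function,
  -- so the change is invisible after applying `P`.
  set c : X → ℂ := a - Pi.single x₀ (inner ℂ (K.ker x₀) v / inner ℂ (K.ker x₀) (K.ker x₀)) with hc
  have hcv : ∑ x, c x • K.ker x = P v := by
    simp only [hc, Pi.sub_apply, sub_smul, Finset.sum_sub_distrib, Pi.single_apply, ite_smul,
      zero_smul, Finset.sum_ite_eq', Finset.mem_univ, if_true]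
    rfl
  have hPv : P v = ∑ x, a x • P (K.ker x) := by simp only [hv, map_sum, map_smul]
  have hPc : ∀ j, ∑ x, (a x * conj (m x 0 j)) • P (K.ker x) =
      P (∑ x, (c x * conj (m x 0 j)) • K.ker x) := by
    intro j
    simp only [map_sum, map_smul]
    refine Finset.sum_congr rfl fun x _ => ?_
    rcases eq_or_ne x x₀ with rfl | h
    · rw [hP, orthComponent_self hx₀, smul_zero, smul_zero]
    · simp [hc, h]
  have key : ∑ j, ‖∑ x, (a x * conj (m x 0 j)) • P (K.ker x)‖ ^ 2 ≤
      ‖∑ x, a x • P (K.ker x)‖ ^ 2 := by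
    rw [← hPv, ← hcv]
    refine le_trans (Finset.sum_le_sum fun j _ => ?_) ((K.norm_multiplier_le_one_iff m).1 hm c)
    rw [hPc]
    gcongr
    exact norm_orthComponent_le hx₀ _
  have h2 := Complex.zero_le_real.2 (sub_nonneg.2 key)
  rw [Complex.ofReal_sub, norm_sq_sum_smul,
    sum_norm_sq_sum_smul (fun x => P (K.ker x)) (fun j x => conj (m x 0 j)) a,
    ← Finset.sum_sub_distrib] at h2
  refine h2.trans_eq (Finset.sum_congr rfl fun x _ => ?_)
  rw [← Finset.sum_sub_distrib]
  refine Finset.sum_congr rfl fun y _ => ?_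
  rw [hP, inner_orthComponent hx₀]
  simp only [Complex.conj_conj]
  ring

/-! ### Positivity of the Pick matrix -/

/-- The matrix `1 - ⟨k_x, k_{x₀}⟩ ⟨k_{x₀}, k_y⟩ / (⟨k_x, k_y⟩ ⟨k_{x₀}, k_{x₀}⟩)`. -/
noncomputable def pickMatrix (K : KernelSpace X H) (x₀ : X) : Matrix X X ℂ :=
  .of fun x y => 1 - inner ℂ (K.ker x) (K.ker x₀) * inner ℂ (K.ker x₀) (K.ker y) /
    (inner ℂ (K.ker x) (K.ker y) * inner ℂ (K.ker x₀) (K.ker x₀))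

theorem pickMatrix_apply (K : KernelSpace X H) (x₀ x y : X) :
    K.pickMatrix x₀ x y = 1 - inner ℂ (K.ker x) (K.ker x₀) * inner ℂ (K.ker x₀) (K.ker y) /
    (inner ℂ (K.ker x) (K.ker y) * inner ℂ (K.ker x₀) (K.ker x₀)) := rfl

theorem conj_pickMatrix (K : KernelSpace X H) (x₀ x y : X) :
    conj (K.pickMatrix x₀ x y) = K.pickMatrix x₀ y x := by
  simp only [pickMatrix_apply, map_sub, map_one, map_div₀, map_mul, inner_conj_symm]
  rw [mul_comm (inner ℂ (K.ker x₀) (K.ker x))]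

theorem pickMatrix_base_left (K : KernelSpace X H) (x₀ y : X) : K.pickMatrix x₀ x₀ y = 0 := by
  have h1 := K.inner_ker_ne_zero x₀ x₀
  have h2 := K.inner_ker_ne_zero x₀ y
  rw [pickMatrix_apply, mul_comm, div_self (mul_ne_zero h2 h1), sub_self]

theorem pickMatrix_base_right (K : KernelSpace X H) (x₀ x : X) : K.pickMatrix x₀ x x₀ = 0 := by
  rw [← conj_pickMatrix, pickMatrix_base_left, map_zero]

/-- The right side is positive of rank one with no zero entries: positivity makes the factorising
row contractive, and the nonvanishing allows dividing it out later. -/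
theorem one_sub_pickMatrix_mul (K : KernelSpace X H) (x₀ x y : X) :
    (1 - K.pickMatrix x₀ x y) * inner ℂ (K.ker x) (K.ker y) =
      inner ℂ (K.ker x) (K.ker x₀) * inner ℂ (K.ker x₀) (K.ker y) /
        inner ℂ (K.ker x₀) (K.ker x₀) := by
  have h1 := K.inner_ker_ne_zero x₀ x₀
  have h2 := K.inner_ker_ne_zero x y
  rw [pickMatrix_apply]
  field_simp
  ring

/-- The matrix `A` with all entries outside `S × S` replaced by zero. -/
noncomputable def maskMatrix [DecidableEq X] (A : Matrix X X ℂ) (S : Finset X) : Matrix X X ℂ :=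
  .of fun x y => if x ∈ S ∧ y ∈ S then A x y else 0

open scoped MatrixOrder in
/-- A positive semidefinite matrix is a Gram matrix. -/
theorem exists_gram_of_posSemidef [Fintype X] {A : Matrix X X ℂ} (hA : A.PosSemidef) :
    ∃ b : X → EuclideanSpace ℂ (Fin (Fintype.card X)), ∀ x y, inner ℂ (b x) (b y) = A x y := by
  classical
  obtain ⟨B, rfl⟩ := CStarAlgebra.nonneg_iff_eq_star_mul_self.mp hA.nonneg
  refine ⟨fun x => WithLp.toLp 2 fun j => B ((Fintype.equivFin X).symm j) x, fun x y => ?_⟩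
  rw [PiLp.inner_apply, Matrix.mul_apply]
  refine Fintype.sum_equiv (Fintype.equivFin X).symm _ _ fun j => ?_
  simp [RCLike.inner_apply, Matrix.star_apply, mul_comm]

/-- Change of base point. Neither `x₀` nor `x₁` need lie in `S`; the Pick property supplies a
contractive extension to all of `X`, hence to `x₀`. -/
theorem CompletePick.posSemidef_maskMatrix_of_mem [Fintype X] [DecidableEq X]
    {K : KernelSpace X H} (hK : K.CompletePick) {S : Finset X} {x₁ : X}
    (h₁ : (maskMatrix (K.pickMatrix x₁) S).PosSemidef) (x₀ : X) :
    (maskMatrix (K.pickMatrix x₀) S).PosSemidef := by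
  obtain ⟨b, hb⟩ := exists_gram_of_posSemidef h₁
  have hb' : ∀ x ∈ S, ∀ y ∈ S, ∑ j, conj (b x j) * b y j = K.pickMatrix x₁ x y := by
    intro x hx y hy
    have := hb x y
    rw [maskMatrix, Matrix.of_apply, if_pos ⟨hx, hy⟩, PiLp.inner_apply] at this
    rw [← this]
    exact Finset.sum_congr rfl fun j _ => by rw [RCLike.inner_apply, mul_comm]
  obtain ⟨m, hm, hmb⟩ := hK.exists_norm_le_one (s := 1) (↑S : Set X)
    (fun x => .of fun _ j => conj (b x j)) (by
    rw [norm_multiplier_le_one_iff]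
    intro c
    simp only [Matrix.of_apply]
    rw [← sub_nonneg, ← Complex.zero_le_real, Complex.ofReal_sub, norm_sq_sum_smul,
      sum_norm_sq_sum_smul (restrict K S).ker (fun j x => conj (conj (b x j))) c,
      ← Finset.sum_sub_distrib]
    -- The defect in the contraction inequality is the squared norm of the projection of `∑ c_x k_x`
    -- onto `k_{x₁}`.
    have h := norm_sq_sum_smul (fun _ : Fin 1 => K.ker x₁) fun _ =>
      ∑ x : (S : Set X), c x * inner ℂ (K.ker x₁) (K.ker x) / inner ℂ (K.ker x₁) (K.ker x₁)
    refine (Complex.zero_le_real.2 (sq_nonneg _)).trans_eq (h.trans ?_)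
    rw [Fin.sum_univ_one, Fin.sum_univ_one, map_sum, Finset.sum_mul_sum, Finset.sum_mul]
    refine Finset.sum_congr rfl fun x _ => ?_
    rw [Finset.sum_mul, ← Finset.sum_sub_distrib]
    refine Finset.sum_congr rfl fun y _ => ?_
    simp only [Complex.conj_conj]
    rw [hb' x x.2 y y.2, Submodule.coe_inner]
    have h3 : ∀ x : (S : Set X), (((restrict K S).ker x : _) : H) = K.ker x := fun x =>
      congrArg Subtype.val (Module.Basis.span_apply
        (K.ker.linearIndependent.comp _ Subtype.val_injective) x)
    rw [h3, h3]
    have h4 := K.one_sub_pickMatrix_mul x₁ x y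
    have h5 := K.inner_ker_ne_zero x₁ x₁
    rw [map_div₀, map_mul, inner_conj_symm, inner_conj_symm]
    calc _ = conj (c x) * c y * (inner ℂ (K.ker x) (K.ker x₁) * inner ℂ (K.ker x₁) (K.ker y) /
        inner ℂ (K.ker x₁) (K.ker x₁)) := by field_simp
      _ = _ := by rw [← h4]; ring)
  refine .of_dotProduct_mulVec_nonneg ?_ fun c => ?_
  · ext x y
    simp only [Matrix.conjTranspose_apply, maskMatrix, Matrix.of_apply, and_comm (a := y ∈ S)]
    split_ifs
    · exact K.conj_pickMatrix x₀ y x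
    · exact star_zero _
  -- On `S` the compressed form is a rank one factor times `pickMatrix x₀`; the division in these
  -- coefficients cancels that factor.
  · have h := K.nonneg_of_norm_multiplier_le_one hm x₀
      fun x => if x ∈ S then c x / inner ℂ (K.ker x₁) (K.ker x) else 0
    have h1 : 0 ≤ inner ℂ (K.ker x₁) (K.ker x₁) := by
      rw [inner_self_eq_norm_sq_to_K]
      exact Complex.zero_le_real.2 (sq_nonneg ‖K.ker x₁‖) |>.trans_eq (Complex.ofReal_pow _ _)
    refine (mul_nonneg h1 h).trans_eq ?_
    simp only [dotProduct, Matrix.mulVec, Finset.mul_sum]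
    refine Finset.sum_congr rfl fun x _ => Finset.sum_congr rfl fun y _ => ?_
    by_cases hx : x ∈ S
    swap
    · simp [hx, maskMatrix]
    by_cases hy : y ∈ S
    swap
    · simp [hy, maskMatrix]
    have h2 : ∑ j, m x 0 j * conj (m y 0 j) = K.pickMatrix x₁ x y := by
      rw [← hb' x hx y hy]
      simp [hmb ⟨x, hx⟩, hmb ⟨y, hy⟩]
    have h3 : inner ℂ (K.ker x) (K.ker y) - inner ℂ (K.ker x) (K.ker x₀) *
        inner ℂ (K.ker x₀) (K.ker y) / inner ℂ (K.ker x₀) (K.ker x₀) =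
        inner ℂ (K.ker x) (K.ker y) * K.pickMatrix x₀ x y := by
      rw [← one_sub_pickMatrix_mul]
      ring
    simp only [hx, hy, if_true, maskMatrix, Matrix.of_apply, and_self, Pi.star_apply]
    rw [h2, h3, map_div₀, inner_conj_symm]
    have h4 := K.one_sub_pickMatrix_mul x₁ x y
    have h5 := K.inner_ker_ne_zero x₁ x₁
    have h6 := K.inner_ker_ne_zero x x₁
    have h7 := K.inner_ker_ne_zero x₁ y
    calc _ = inner ℂ (K.ker x₁) (K.ker x₁) * (conj (c x) / inner ℂ (K.ker x) (K.ker x₁) *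
          (c y / inner ℂ (K.ker x₁) (K.ker y)) *
          ((1 - K.pickMatrix x₁ x y) * inner ℂ (K.ker x) (K.ker y)) * K.pickMatrix x₀ x y) := by
            ring
      _ = _ := by
        rw [h4, starRingEnd_apply]
        field_simp

theorem CompletePick.posSemidef_maskMatrix [Fintype X] [DecidableEq X] {K : KernelSpace X H}
    (hK : K.CompletePick) (S : Finset X) (x₀ : X) :
    (maskMatrix (K.pickMatrix x₀) S).PosSemidef := by
  induction S using Finset.induction generalizing x₀ with
  | empty =>
    convert Matrix.PosSemidef.zero (n := X) (R := ℂ)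
    ext x y
    simp [maskMatrix]
  | insert x₁ S hx₁ ih =>
    -- With the new point as base, its row and column are zero, so the masks over `insert x₁ S` and
    -- `S` coincide.
    refine hK.posSemidef_maskMatrix_of_mem (x₁ := x₁) ?_ x₀
    convert ih x₁ using 1
    ext x y
    simp only [maskMatrix, Matrix.of_apply, Finset.mem_insert]
    rcases eq_or_ne x x₁ with rfl | hx
    · simp [K.pickMatrix_base_left, hx₁]
    · rcases eq_or_ne y x₁ with rfl | hy
      · simp [K.pickMatrix_base_right, hx₁]
      · simp [hx, hy]

/-- The McCullough-Quiggin condition. -/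
theorem CompletePick.posSemidef_pickMatrix [Fintype X] {K : KernelSpace X H}
    (hK : K.CompletePick) (x₀ : X) : (K.pickMatrix x₀).PosSemidef := by
  classical
  convert hK.posSemidef_maskMatrix Finset.univ x₀
  ext x y
  simp [maskMatrix]

/-- The indices are swapped to match `gram`, where `gram x y` is `inner ℂ (ker y) (ker x)`. -/
theorem CompletePick.exists_gram_eq_pickMatrix [Fintype X] {K : KernelSpace X H}
    (hK : K.CompletePick) (x₀ : X) :
    ∃ b : X → EuclideanSpace ℂ (Fin (Fintype.card X)),
      ∀ x y, inner ℂ (b x) (b y) = K.pickMatrix x₀ y x :=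
  exists_gram_of_posSemidef (hK.posSemidef_pickMatrix x₀).transpose

end KernelSpace

/-! ### Embedding into the Drury–Arveson space -/

theorem KernelSpace.gram_DA {n : ℕ} (Y : Set (CHyp n)) (x y : Y) :
    (DA n Y).gram x y = (1 - inner ℂ (x : EuclideanSpace ℂ (Fin n))
      (y : EuclideanSpace ℂ (Fin n)))⁻¹ := by
  have h : ∀ x : Y, (((DA n Y).ker x : _) : DruryArveson n) = daKer (x : CHyp n) := fun x =>
    congrArg Subtype.val (Module.Basis.span_apply
      ((linearIndependent_daKer n).comp _ Subtype.val_injective) x)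
  rw [KernelSpace.gram, KernelSpace.value, Submodule.coe_inner, h, h, inner_daKer, daKer_apply]

theorem inner_self_eq_ofReal_norm_sq {E : Type*} [NormedAddCommGroup E] [InnerProductSpace ℂ E]
    (v : E) : inner ℂ v v = ((‖v‖ ^ 2 : ℝ) : ℂ) := by
  rw [inner_self_eq_norm_sq_to_K]
  norm_cast

theorem theorem5p9 {X H : Type*} [Finite X] [NormedAddCommGroup H] [InnerProductSpace ℂ H]
    (K : KernelSpace X H) (hK : K.CompletePick) :
    ∃ n : ℕ, 1 ≤ n ∧ ∃ Y : Set (CHyp n), Y.Finite ∧ K.Rescales (DA n Y) := by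
  have := Fintype.ofFinite X
  rcases isEmpty_or_nonempty X with hX | ⟨⟨x₀⟩⟩
  · exact ⟨1, le_rfl, ∅, Set.finite_empty, Equiv.equivOfIsEmpty _ _, fun _ => 1,
      fun x => hX.elim x, fun x => hX.elim x⟩
  obtain ⟨b, hb⟩ := hK.exists_gram_eq_pickMatrix x₀
  have h00 := K.inner_ker_ne_zero x₀ x₀
  have hpos : ∀ x, 0 < ‖K.ker x‖ := fun x => norm_pos_iff.2 (K.ker.ne_zero x)
  have hball : ∀ x, b x ∈ Metric.ball (0 : EuclideanSpace ℂ (Fin (Fintype.card X))) 1 := by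
    intro x
    have h1 := hb x x
    rw [K.pickMatrix_apply, inner_self_eq_ofReal_norm_sq, inner_self_eq_ofReal_norm_sq, inner_self_eq_ofReal_norm_sq, ← inner_conj_symm, Complex.conj_mul'] at h1
    have h2 : ‖b x‖ ^ 2 = 1 - ‖inner ℂ (K.ker x₀) (K.ker x)‖ ^ 2 /
        (‖K.ker x‖ ^ 2 * ‖K.ker x₀‖ ^ 2) := by exact_mod_cast h1
    -- Nonvanishing of the kernel puts `b x` strictly inside the ball.
    have h3 : 0 < ‖inner ℂ (K.ker x₀) (K.ker x)‖ := norm_pos_iff.2 (K.inner_ker_ne_zero x₀ x)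
    have h4 : 0 < ‖inner ℂ (K.ker x₀) (K.ker x)‖ ^ 2 / (‖K.ker x‖ ^ 2 * ‖K.ker x₀‖ ^ 2) := by
      have := hpos x
      have := hpos x₀
      positivity
    rw [mem_ball_zero_iff, ← sq_lt_one_iff₀ (norm_nonneg _), h2]
    linarith
  have hgram : ∀ x y, (1 - inner ℂ (b x) (b y))⁻¹ = inner ℂ (K.ker y) (K.ker x) *
      inner ℂ (K.ker x₀) (K.ker x₀) /
        (inner ℂ (K.ker y) (K.ker x₀) * inner ℂ (K.ker x₀) (K.ker x)) := by
    intro x y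
    rw [hb, K.pickMatrix_apply, sub_sub_cancel, inv_div]
  set f : X → CHyp (Fintype.card X) := fun x => ⟨b x, hball x⟩ with hf
  have hinj : Function.Injective f := by
    intro x y hxy
    by_contra hne
    have hbxy : b x = b y := congrArg Subtype.val hxy
    -- If `b x = b y`, the Gram determinant of `k_x` and `k_y` vanishes, so `k_y` is a multiple of
    -- `k_x`, contradicting independence.
    have hdet : inner ℂ (K.ker y) (K.ker y) -
        inner ℂ (K.ker y) (K.ker x) * inner ℂ (K.ker x) (K.ker y) /
          inner ℂ (K.ker x) (K.ker x) = 0 := by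
      have h1 := hgram x x
      have h2 := hgram x y
      have h3 := hgram y x
      have h4 := hgram y y
      rw [← hbxy] at h2 h3 h4
      have h5 := congrArg₂ (· * ·) (h1.symm.trans h2) (h4.symm.trans h3)
      have := K.inner_ker_ne_zero x x
      have := K.inner_ker_ne_zero x x₀
      have := K.inner_ker_ne_zero x₀ x
      have := K.inner_ker_ne_zero y x₀
      have := K.inner_ker_ne_zero x₀ y
      field_simp at h5 ⊢
      linear_combination h5
    rw [← KernelSpace.inner_orthComponent (K.ker.ne_zero x), inner_self_eq_zero,
      KernelSpace.orthComponent_apply, sub_eq_zero] at hdet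
    have h := congrArg (fun v => K.ker.repr v y) hdet
    simp [hne] at h
  -- The factor `γ` is read off from `hgram`, with `⟨k_{x₀}, k_{x₀}⟩` split as `‖k_{x₀}‖ *
  -- ‖k_{x₀}‖`.
  refine ⟨Fintype.card X, Fintype.card_pos_iff.2 ⟨x₀⟩, Set.range f, Set.finite_range f,
    Equiv.ofInjective f hinj, fun x => ‖K.ker x₀‖ / inner ℂ (K.ker x₀) (K.ker x),
    fun x => div_ne_zero (by exact_mod_cast (hpos x₀).ne') (K.inner_ker_ne_zero _ _),
    fun x y => ?_⟩
  rw [KernelSpace.gram_DA]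
  refine (hgram x y).trans ?_
  rw [map_div₀, inner_conj_symm, Complex.conj_ofReal, inner_self_eq_ofReal_norm_sq (K.ker x₀), KernelSpace.gram, KernelSpace.value]
  push_cast
  ring
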